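/- Let $G=(V,E)$ be a directed graph (loops allowed) on a finite nonempty set $V$ of terminals, and let $w_i>0$ for $i\in V$. For a trajectory $m(0),m(1),\dots$ in $V$ and initial ages $A_i(0)\in\mathbb{N}$, let the age of terminal $i$ evolve by $A_i(t+1)=1$ if $m(t)=i$ and $A_i(t+1)=A_i(t)+1$ otherwise. The network peak age of the trajectory is $$A^{\mathrm p}=\sum_{i\in V}w_i\,\limsup_{T\to\infty}\frac{\sum_{t=1}^{T}A_i(t)\mathbf 1_{\{m(t)=i\}}}{\sum_{t=1}^{T}\mathbf 1_{\{m(t)=i\}}}.$$ A randomized trajectory on $G$ is an irreducible stochastic matrix $P$ on $V$ with $P_{i,j}=0$ whenever $(i,j)\notin E$. We write $A^{\mathrm p}(P)=c$ if, for every Markov chain $m(t)$ with transition matrix $P$ (any initial distribution, any initial ages), the network peak age equals $c$ almost surely. The matrix $P$ is called peak-age optimal over the randomized trajectories if it is a randomized trajectory on $G$, $A^{\mathrm p}(P)$ exists and is finite, and for every randomized trajectory $Q$ on $G$, $A^{\mathrm p}(Q)$ exists, is finite, and $A^{\mathrm p}(P)\le A^{\mathrm p}(Q)$. The peak-age minimization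 problem is $$\text{minimize }\sum_{i\in V}\frac{w_i}{\pi_i}\quad\text{over the pairs }(P,\pi),$$ where $P$ is a randomized trajectory on $G$ and $\pi$ is a probability distribution on $V$ with $\pi P=\pi$. Let $\pi^*_i=\sqrt{w_i}/\sum_{j\in V}\sqrt{w_j}$. (a) If $P$ is a randomized trajectory on $G$ with $\pi^*P=\pi^*$, then $(P,\pi^*)$ solves the peak-age minimization problem, and $P$ is peak-age optimal over the randomized trajectories on $G$. (b) Suppose that $G$ is undirected ($(i,j)\in E$ implies $(j,i)\in E$) and connected, and that the agent may stay where it is ($(i,i)\in E$ for all $i$). Let $d_i$ be the number of $j\ne i$ with $(i,j)\in E$, let $P^{\mathrm{rw}}_{i,j}=1/d_i$ if $i\ne j$ and $(i,j)\in E$, and $P^{\mathrm{rw}}_{i,j}=0$ otherwise. Define the Metropolis--Hastings matrix by $$P^{\mathrm{mh}}_{i,j}=P^{\mathrm{rw}}_{i,j}\min\Bigl(1,\frac{\pi^*_jP^{\mathrm{rw}}_{j,i}}{\pi^*_iP^{\mathrm{rw}}_{i,j}}\Bigr)\ \text{ if } i\ne j,\ (i,j)\in E,\qquad P^{\mathrm{mh}}_{i,i}=1-\sum_{j\ne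 i}P^{\mathrm{mh}}_{i,j},$$ and $P^{\mathrm{mh}}_{i,j}=0$ otherwise. Then $P^{\mathrm{mh}}$ is a randomized trajectory on $G$ with $\pi^*P^{\mathrm{mh}}=\pi^*$, the pair $(P^{\mathrm{mh}},\pi^*)$ solves the peak-age minimization problem, and $P^{\mathrm{mh}}$ is peak-age optimal over the randomized trajectories on $G$. -/

import Mathlib

open MeasureTheory Filter
open scoped ENNReal NNReal Matrix

universe u v

namespace PeakAge

noncomputable section

/-- Age of terminal `i` under the trajectory `m`, with initial age `a i` at time `0`:
`A i (t+1) = 1` if `m t = i`, and `A i (t+1) = A i t + 1` otherwise. -/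
def age {V : Type u} [DecidableEq V] (a : V → ℕ) (m : ℕ → V) (i : V) : ℕ → ℕ
  | 0 => a i
  | t + 1 => if m t = i then 1 else age a m i t + 1

/-- The average over the visits to `i` in the slots `1, …, T` of the age of `i` at the visit. -/
def peakAverage {V : Type u} [DecidableEq V] (a : V → ℕ) (m : ℕ → V) (i : V) (T : ℕ) : ℝ :=
  (∑ t ∈ Finset.Icc 1 T, (age a m i t : ℝ) * (if m t = i then 1 else 0)) /
    (∑ t ∈ Finset.Icc 1 T, (if m t = i then 1 else 0))

/-- Peak age of terminal `i` along a trajectory, as an extended nonnegative number. -/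
def peakAge {V : Type u} [DecidableEq V] (a : V → ℕ) (m : ℕ → V) (i : V) : ℝ≥0∞ :=
  limsup (fun T : ℕ => ENNReal.ofReal (peakAverage a m i T)) atTop

/-- Network peak age along a trajectory, for the weights `w`. -/
def networkPeakAge {V : Type u} [Fintype V] [DecidableEq V] (w : V → ℝ) (a : V → ℕ)
    (m : ℕ → V) : ℝ≥0∞ :=
  ∑ i, ENNReal.ofReal (w i) * peakAge a m i

/-- `m` is a time-homogeneous Markov chain with transition matrix `P` (and arbitrary initial
distribution): given that the path up to time `n` is `x 0, …, x n`, the next state is `x (n+1)`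
with probability `P (x n) (x (n+1))`. -/
structure IsMarkovChain {V : Type u} (P : Matrix V V ℝ) {Ω : Type v} [MeasurableSpace Ω]
    (μ : Measure Ω) (m : ℕ → Ω → V) : Prop where
  isProbabilityMeasure : IsProbabilityMeasure μ
  measurableSet_eq : ∀ (t : ℕ) (i : V), MeasurableSet {ω | m t ω = i}
  transition : ∀ (n : ℕ) (x : ℕ → V),
    μ {ω | ∀ k ≤ n + 1, m k ω = x k} =
      μ {ω | ∀ k ≤ n, m k ω = x k} * ENNReal.ofReal (P (x n) (x (n + 1)))

/-- `P` is (the transition matrix of) a randomized trajectory on the mobility graph `G`. -/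
structure IsRandomizedTrajectory {V : Type u} [Fintype V] [DecidableEq V] (G : Digraph V)
    (P : Matrix V V ℝ) : Prop where
  stochastic : P ∈ Matrix.rowStochastic ℝ V
  supported : ∀ i j, ¬ G.Adj i j → P i j = 0
  irreducible : P.IsIrreducible

/-- The network peak age of the randomized trajectory `P` is the number `c`: almost every path of
every Markov chain with transition matrix `P` has network peak age `c`, whatever the initial
distribution and the initial ages. -/
def HasPeakAge {V : Type u} [Fintype V] [DecidableEq V] (w : V → ℝ) (P : Matrix V V ℝ)
    (c : ℝ≥0) : Prop :=
  ∀ (Ω : Type v) [MeasurableSpace Ω] (μ : Measure Ω) (m : ℕ → Ω → V), IsMarkovChain P μ m →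
    ∀ a : V → ℕ, ∀ᵐ ω ∂μ, networkPeakAge w a (fun t => m t ω) = c

/-- `P` is a randomized trajectory on `G` of minimal network peak age among all of them; every
randomized trajectory has a well-defined finite network peak age. -/
def IsPeakAgeOptimal {V : Type u} [Fintype V] [DecidableEq V] (G : Digraph V) (w : V → ℝ)
    (P : Matrix V V ℝ) : Prop :=
  IsRandomizedTrajectory G P ∧
    ∃ c : ℝ≥0, HasPeakAge.{u, v} w P c ∧
      ∀ Q : Matrix V V ℝ, IsRandomizedTrajectory G Q →
        ∃ d : ℝ≥0, HasPeakAge.{u, v} w Q d ∧ c ≤ d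

/-- Feasible set of the peak-age minimization problem: a randomized trajectory `P` with a
stationary distribution `π`. -/
def feasible {V : Type u} [Fintype V] [DecidableEq V] (G : Digraph V) :
    Set (Matrix V V ℝ × (V → ℝ)) :=
  {x | IsRandomizedTrajectory G x.1 ∧ x.2 ∈ stdSimplex ℝ V ∧ x.2 ᵥ* x.1 = x.2}

/-- `(P, π)` solves the problem of minimizing `∑ i, w i / π i` over the feasible pairs.
(Irreducibility of `P` forces `π i > 0` on the feasible set.) -/
def SolvesPeakAgeProblem {V : Type u} [Fintype V] [DecidableEq V] (G : Digraph V) (w : V → ℝ)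
    (P : Matrix V V ℝ) (π : V → ℝ) : Prop :=
  (P, π) ∈ feasible G ∧
    IsMinOn (fun x : Matrix V V ℝ × (V → ℝ) => ∑ i, w i / x.2 i) (feasible G) (P, π)

/-- The distribution proportional to `√w`. -/
def piStar {V : Type u} [Fintype V] (w : V → ℝ) (i : V) : ℝ :=
  √(w i) / ∑ j, √(w j)

/-- Number of out-neighbours of `i` other than `i` itself. -/
def outDegree {V : Type u} [Fintype V] [DecidableEq V] (G : Digraph V) [DecidableRel G.Adj]
    (i : V) : ℕ :=
  (Finset.univ.filter fun j => i ≠ j ∧ G.Adj i j).card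

/-- The simple random walk on `G`. -/
def Prw {V : Type u} [Fintype V] [DecidableEq V] (G : Digraph V) [DecidableRel G.Adj] :
    Matrix V V ℝ :=
  fun i j => if i ≠ j ∧ G.Adj i j then 1 / (outDegree G i : ℝ) else 0

/-- Off-diagonal entries of the Metropolis–Hastings matrix. -/
def mhOffDiag {V : Type u} [Fintype V] [DecidableEq V] (G : Digraph V) [DecidableRel G.Adj]
    (w : V → ℝ) (i j : V) : ℝ :=
  if i ≠ j ∧ G.Adj i j then
    Prw G i j * min 1 ((piStar w j * Prw G j i) / (piStar w i * Prw G i j))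
  else 0

/-- The Metropolis–Hastings matrix built from the simple random walk, with target `piStar w`. -/
def Pmh {V : Type u} [Fintype V] [DecidableEq V] (G : Digraph V) [DecidableRel G.Adj]
    (w : V → ℝ) : Matrix V V ℝ :=
  fun i j =>
    if i = j then 1 - ∑ k ∈ Finset.univ.filter (fun k => k ≠ i), mhOffDiag G w i k
    else mhOffDiag G w i j

end

end PeakAge

/-! The ages at the visits to `i` telescope: up to slot `T` they add up to `T` plus a constant minus
the current age, which is small right after a visit. Hence the peak age of `i` is the reciprocal of
its visit frequency (`peakAge_eq_of_tendsto`). For an irreducible chain this frequency is the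
stationary probability `p i`, so the network peak age is `∑ i, w i / p i`
(`hasPeakAge_of_stationary`). Cauchy–Schwarz bounds this sum below by `(∑ i, √(w i)) ^ 2`, the value
at `piStar w` (`sum_div_piStar_le`), which settles (a). Part (b) reduces to (a) by detailed balance
and irreducibility.

The law of large numbers needs no aperiodicity and no return times. The Poisson equation `g - P g =
f` turns sums of a centred `f` into a martingale with bounded increments, up to a bounded error. Its
second moment grows linearly, which gives almost sure convergence along the squares, and bounded
increments fill the gaps. -/

namespace PeakAge

/-! ### Irreducible stochastic matrices: harmonic functions, stationarity, Poisson equation -/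

section Stochastic

variable {V : Type u} [Fintype V] [DecidableEq V] {P : Matrix V V ℝ}

lemma exists_pow_apply_pos (hirr : P.IsIrreducible) (i j : V) : ∃ k : ℕ, 0 < (P ^ k) i j := by
  obtain ⟨k, -, hk⟩ := (Matrix.isIrreducible_iff_exists_pow_pos hirr.nonneg).1 hirr i j
  exact ⟨k, hk⟩

/-- A harmonic function of an irreducible stochastic matrix is constant. -/
lemma eq_of_mulVec_eq_self (hP : P ∈ Matrix.rowStochastic ℝ V) (hirr : P.IsIrreducible)
    {g : V → ℝ} (hg : P *ᵥ g = g) (i j : V) : g i = g j := by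
  have : Nonempty V := ⟨i⟩
  obtain ⟨a, ha⟩ := Finite.exists_max g
  have key : ∀ b, g b = g a := by
    intro b
    obtain ⟨k, hk⟩ := exists_pow_apply_pos hirr a b
    have hPk : P ^ k ∈ Matrix.rowStochastic ℝ V := pow_mem hP k
    have hgk : P ^ k *ᵥ g = g := by
      clear hk hPk
      induction k with
      | zero => simp
      | succ k ih => rw [pow_succ, ← Matrix.mulVec_mulVec, hg, ih]
    -- Maximum principle: `g a` is a weighted mean of values at most `g a`, so every value of
    -- positive weight equals it.
    have hsum : ∑ c, (P ^ k) a c * (g a - g c) = 0 := by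
      have h1 := congrFun hgk a
      simp only [Matrix.mulVec, dotProduct] at h1
      simp only [mul_sub, Finset.sum_sub_distrib]
      rw [h1, ← Finset.sum_mul, Matrix.sum_row_of_mem_rowStochastic hPk]
      ring
    have hz := (Finset.sum_eq_zero_iff_of_nonneg (fun c _ => mul_nonneg
      (Matrix.nonneg_of_mem_rowStochastic hPk) (sub_nonneg.2 (ha c)))).1 hsum b
      (Finset.mem_univ b)
    rcases mul_eq_zero.1 hz with h | h
    · exact absurd h hk.ne'
    · linarith
  rw [key i, key j]

/-- Stationary distributions of irreducible matrices have full support. -/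
lemma pos_of_vecMul_eq_self (hirr : P.IsIrreducible) {p : V → ℝ} (hp : p ∈ stdSimplex ℝ V)
    (hst : p ᵥ* P = p) (j : V) : 0 < p j := by
  obtain ⟨i, hi⟩ : ∃ i, 0 < p i := by
    by_contra! h
    have : ∑ i, p i ≤ 0 := Finset.sum_nonpos fun i _ => h i
    rw [hp.2] at this
    linarith
  obtain ⟨k, hk⟩ := exists_pow_apply_pos hirr i j
  have hpk : p ᵥ* P ^ k = p := by
    clear hk
    induction k with
    | zero => simp
    | succ k ih => rw [pow_succ, ← Matrix.vecMul_vecMul, ih, hst]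
  rw [← congrFun hpk j]
  refine Finset.sum_pos' (fun c _ => mul_nonneg (hp.1 c) ?_) ⟨i, Finset.mem_univ i, mul_pos hi hk⟩
  exact Matrix.pow_apply_nonneg hirr.nonneg k c j

/-- Every stochastic matrix has a stationary distribution. -/
lemma exists_stationary [Nonempty V] (hP : P ∈ Matrix.rowStochastic ℝ V) :
    ∃ p ∈ stdSimplex ℝ V, p ᵥ* P = p := by
  -- `P - 1` kills the constants, so it also has a left null vector `v`. Entrywise `|v| ≤ |v| P`,
  -- and both sides have the same total mass, so `|v|` is invariant.
  have hdet : (P - 1).det = 0 :=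
    Matrix.exists_mulVec_eq_zero_iff.1 ⟨1, one_ne_zero, by
      rw [Matrix.sub_mulVec, Matrix.one_vecMul_of_mem_rowStochastic hP, Matrix.one_mulVec,
        sub_self]⟩
  obtain ⟨v, hv0, hv⟩ := Matrix.exists_vecMul_eq_zero_iff.2 hdet
  rw [Matrix.vecMul_sub, Matrix.vecMul_one, sub_eq_zero] at hv
  have hle : ∀ j, |v j| ≤ ∑ i, |v i| * P i j := fun j => by
    conv_lhs => rw [← congrFun hv j]
    refine (Finset.abs_sum_le_sum_abs _ _).trans (le_of_eq (Finset.sum_congr rfl fun i _ => ?_))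
    rw [abs_mul, abs_of_nonneg (Matrix.nonneg_of_mem_rowStochastic hP)]
  have hsum : ∑ j, ∑ i, |v i| * P i j = ∑ j, |v j| := by
    rw [Finset.sum_comm]
    simp only [← Finset.mul_sum, Matrix.sum_row_of_mem_rowStochastic hP, mul_one]
  have heq : ∀ j, |v j| = ∑ i, |v i| * P i j := fun j =>
    (Finset.sum_eq_sum_iff_of_le fun j _ => hle j).1 hsum.symm j (Finset.mem_univ j)
  have hpos : 0 < ∑ j, |v j| := by
    obtain ⟨i, hi⟩ := Function.ne_iff.1 hv0
    exact Finset.sum_pos' (fun _ _ => abs_nonneg _) ⟨i, Finset.mem_univ i, abs_pos.2 hi⟩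
  refine ⟨fun i => |v i| / ∑ j, |v j|, ⟨fun i => by positivity, ?_⟩, ?_⟩
  · rw [← Finset.sum_div, div_self hpos.ne']
  · ext j
    simp only [Matrix.vecMul, dotProduct, div_mul_eq_mul_div]
    rw [← Finset.sum_div, ← heq]

/-- Solvability of the Poisson equation `g - P g = f` for `f` of mean zero under the stationary
distribution. -/
lemma exists_poisson_solution [Nonempty V] (hP : P ∈ Matrix.rowStochastic ℝ V)
    (hirr : P.IsIrreducible) {p : V → ℝ} (hp : p ∈ stdSimplex ℝ V) (hst : p ᵥ* P = p)
    {f : V → ℝ} (hf : p ⬝ᵥ f = 0) : ∃ g : V → ℝ, ∀ i, g i = f i + (P *ᵥ g) i := by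
  -- The rank-one term makes `1 - P` invertible: it preserves the `p`-mean, so a kernel element is
  -- harmonic of mean zero, hence zero.
  let B : (V → ℝ) →ₗ[ℝ] (V → ℝ) :=
    LinearMap.id - P.mulVecLin + (dotProductBilin ℝ ℝ p).smulRight (1 : V → ℝ)
  have hB : ∀ g, B g = g - P *ᵥ g + (p ⬝ᵥ g) • (1 : V → ℝ) := fun g => rfl
  have hp1 : p ⬝ᵥ (1 : V → ℝ) = 1 := by rw [dotProduct_one]; exact hp.2
  have hpB : ∀ g, p ⬝ᵥ B g = p ⬝ᵥ g := fun g => by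
    rw [hB, dotProduct_add, dotProduct_sub, Matrix.dotProduct_mulVec, hst, dotProduct_smul, hp1]
    simp
  have hinj : Function.Injective B := by
    rw [injective_iff_map_eq_zero]
    intro g hg
    have h0 : p ⬝ᵥ g = 0 := by rw [← hpB, hg, dotProduct_zero]
    have hharm : P *ᵥ g = g := by
      have := hB g
      rw [hg, h0, zero_smul, add_zero] at this
      exact (sub_eq_zero.1 this.symm).symm
    ext i
    have hconst := eq_of_mulVec_eq_self hP hirr hharm
    have : p ⬝ᵥ g = g i := by
      simp only [dotProduct]
      rw [Finset.sum_congr rfl fun j _ => by rw [hconst j i], ← Finset.sum_mul, hp.2, one_mul]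
    rw [← this, h0, Pi.zero_apply]
  obtain ⟨g, hg⟩ := LinearMap.injective_iff_surjective.1 hinj f
  refine ⟨g, fun i => ?_⟩
  have h0 : p ⬝ᵥ g = 0 := by rw [← hpB, hg, hf]
  have := congrFun (hB g) i
  rw [hg, h0] at this
  simp at this
  linarith

end Stochastic

/-! ### Minimizing the sum of `w i / p i` over the simplex -/

section Target

variable {V : Type u} [Fintype V] {w : V → ℝ}

lemma sum_sqrt_pos [Nonempty V] (hw : ∀ i, 0 < w i) : 0 < ∑ j, √(w j) :=
  Finset.sum_pos (fun i _ => Real.sqrt_pos.2 (hw i)) Finset.univ_nonempty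

lemma piStar_pos [Nonempty V] (hw : ∀ i, 0 < w i) (i : V) : 0 < piStar w i :=
  div_pos (Real.sqrt_pos.2 (hw i)) (sum_sqrt_pos hw)

lemma piStar_mem_stdSimplex [Nonempty V] (hw : ∀ i, 0 < w i) : piStar w ∈ stdSimplex ℝ V :=
  ⟨fun i => (piStar_pos hw i).le, by
    simp only [piStar, ← Finset.sum_div]
    exact div_self (sum_sqrt_pos hw).ne'⟩

lemma sum_div_piStar [Nonempty V] (hw : ∀ i, 0 < w i) :
    ∑ i, w i / piStar w i = (∑ i, √(w i)) ^ 2 := by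
  rw [sq, Finset.sum_mul]
  refine Finset.sum_congr rfl fun i _ => ?_
  have h1 := (Real.sqrt_pos.2 (hw i)).ne'
  have h2 := (sum_sqrt_pos hw).ne'
  rw [piStar, div_div_eq_mul_div, div_eq_iff h1]
  nth_rewrite 1 [← Real.mul_self_sqrt (hw i).le]
  ring

/-- Cauchy–Schwarz in the form `(∑ a i) ^ 2 / ∑ p i ≤ ∑ a i ^ 2 / p i`, with `a i = √(w i)`. -/
lemma sum_div_piStar_le [Nonempty V] (hw : ∀ i, 0 < w i) {p : V → ℝ} (hp : ∀ i, 0 < p i)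
    (hsum : ∑ i, p i = 1) : ∑ i, w i / piStar w i ≤ ∑ i, w i / p i := by
  rw [sum_div_piStar hw]
  have := Finset.sq_sum_div_le_sum_sq_div Finset.univ (fun i => √(w i)) (fun i _ => hp i)
  rw [hsum, div_one] at this
  exact this.trans_eq (Finset.sum_congr rfl fun i _ => by rw [Real.sq_sqrt (hw i).le])

variable [DecidableEq V] [Nonempty V] {G : Digraph V} {P : Matrix V V ℝ}

lemma solvesPeakAgeProblem_piStar (hw : ∀ i, 0 < w i) (hP : IsRandomizedTrajectory G P)
    (hst : piStar w ᵥ* P = piStar w) : SolvesPeakAgeProblem G w P (piStar w) :=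
  ⟨⟨hP, piStar_mem_stdSimplex hw, hst⟩, fun _ hx =>
    sum_div_piStar_le hw (pos_of_vecMul_eq_self hx.1.irreducible hx.2.1 hx.2.2) hx.2.1.2⟩

end Target

/-! ### The Metropolis–Hastings chain -/

section MetropolisHastings

variable {V : Type u} [Fintype V] [DecidableEq V] {G : Digraph V} [DecidableRel G.Adj]
  {w : V → ℝ}

lemma Prw_nonneg (i j : V) : 0 ≤ Prw G i j := by
  unfold Prw; split_ifs <;> positivity

lemma Prw_pos {i j : V} (hij : i ≠ j) (h : G.Adj i j) : 0 < Prw G i j := by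
  have : 0 < outDegree G i := Finset.card_pos.2 ⟨j, by simp [hij, h]⟩
  rw [Prw, if_pos ⟨hij, h⟩]
  positivity

lemma sum_Prw_le_one (i : V) : ∑ j, Prw G i j ≤ 1 := by
  simp only [Prw]
  rw [← Finset.sum_filter, Finset.sum_const, nsmul_eq_mul, mul_one_div]
  -- Only an inequality: a single terminal has out-degree `0`, and then its row is zero.
  exact div_self_le_one _

lemma mhOffDiag_pos [Nonempty V] (hw : ∀ i, 0 < w i) (hsymm : ∀ i j, G.Adj i j → G.Adj j i)
    {i j : V} (hij : i ≠ j) (h : G.Adj i j) : 0 < mhOffDiag G w i j := by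
  rw [mhOffDiag, if_pos ⟨hij, h⟩]
  have h1 := Prw_pos hij h
  have h2 := Prw_pos hij.symm (hsymm i j h)
  have h3 := piStar_pos hw i
  have h4 := piStar_pos hw j
  exact mul_pos h1 (lt_min one_pos (by positivity))

lemma mhOffDiag_nonneg [Nonempty V] (hw : ∀ i, 0 < w i) (i j : V) : 0 ≤ mhOffDiag G w i j := by
  rw [mhOffDiag]
  split_ifs with h
  · have h3 := piStar_pos hw i
    have h4 := piStar_pos hw j
    have h1 := Prw_nonneg (G := G) i j
    have h2 := Prw_nonneg (G := G) j i
    exact mul_nonneg h1 (le_min zero_le_one (by positivity))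
  · exact le_rfl

lemma mhOffDiag_le_Prw (i j : V) : mhOffDiag G w i j ≤ Prw G i j := by
  rw [mhOffDiag]
  split_ifs with h
  · exact mul_le_of_le_one_right (Prw_nonneg i j) (min_le_left _ _)
  · exact Prw_nonneg i j

lemma sum_mhOffDiag_le_one [Nonempty V] (hw : ∀ i, 0 < w i) (i : V) :
    ∑ k ∈ Finset.univ.filter (fun k => k ≠ i), mhOffDiag G w i k ≤ 1 :=
  (Finset.sum_le_univ_sum_of_nonneg (mhOffDiag_nonneg hw i)).trans <|
    (Finset.sum_le_sum fun k _ => mhOffDiag_le_Prw i k).trans (sum_Prw_le_one i)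

/-- Detailed balance. -/
lemma piStar_mul_Pmh_comm [Nonempty V] (hw : ∀ i, 0 < w i)
    (hsymm : ∀ i j, G.Adj i j → G.Adj j i) (i j : V) :
    piStar w i * Pmh G w i j = piStar w j * Pmh G w j i := by
  have key : ∀ i j, i ≠ j → G.Adj i j →
      piStar w i * mhOffDiag G w i j = min (piStar w i * Prw G i j) (piStar w j * Prw G j i) := by
    intro i j hij h
    have hpos := mul_pos (piStar_pos hw i) (Prw_pos hij h)
    rw [mhOffDiag, if_pos ⟨hij, h⟩, ← mul_assoc, mul_min_of_nonneg _ _ hpos.le, mul_one,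
      mul_div_cancel₀ _ hpos.ne']
  by_cases hij : i = j
  · rw [hij]
  · rw [Pmh, Pmh, if_neg hij, if_neg (Ne.symm hij)]
    by_cases h : G.Adj i j
    · rw [key i j hij h, key j i (Ne.symm hij) (hsymm i j h), min_comm]
    · have h' : ¬ G.Adj j i := fun h' => h (hsymm j i h')
      simp [mhOffDiag, h, h']

lemma Pmh_nonneg [Nonempty V] (hw : ∀ i, 0 < w i) (i j : V) : 0 ≤ Pmh G w i j := by
  rw [Pmh]
  split_ifs with h
  · exact sub_nonneg.2 (sum_mhOffDiag_le_one hw i)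
  · exact mhOffDiag_nonneg hw i j

lemma sum_Pmh (i : V) : ∑ j, Pmh G w i j = 1 := by
  rw [← Finset.sum_filter_add_sum_filter_not Finset.univ (fun k => k ≠ i)]
  have h1 : ∑ k ∈ Finset.univ.filter (fun k => k ≠ i), Pmh G w i k =
      ∑ k ∈ Finset.univ.filter (fun k => k ≠ i), mhOffDiag G w i k :=
    Finset.sum_congr rfl fun k hk => by
      rw [Pmh, if_neg (Ne.symm (Finset.mem_filter.1 hk).2)]
  have h2 : Finset.univ.filter (fun k => ¬ k ≠ i) = {i} := by ext; simp
  rw [h1, h2, Finset.sum_singleton, Pmh, if_pos rfl]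
  ring

lemma Pmh_mem_rowStochastic [Nonempty V] (hw : ∀ i, 0 < w i) :
    Pmh G w ∈ Matrix.rowStochastic ℝ V :=
  Matrix.mem_rowStochastic_iff_sum.2 ⟨Pmh_nonneg hw, sum_Pmh⟩

lemma piStar_vecMul_Pmh [Nonempty V] (hw : ∀ i, 0 < w i)
    (hsymm : ∀ i j, G.Adj i j → G.Adj j i) : piStar w ᵥ* Pmh G w = piStar w := by
  ext j
  simp only [Matrix.vecMul, dotProduct]
  rw [Finset.sum_congr rfl fun i _ => piStar_mul_Pmh_comm hw hsymm i j, ← Finset.mul_sum,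
    sum_Pmh, mul_one]

lemma Pmh_isIrreducible [Nonempty V] (hw : ∀ i, 0 < w i) (hsymm : ∀ i j, G.Adj i j → G.Adj j i)
    (hconn : ∀ i j, Relation.ReflTransGen G.Adj i j) : (Pmh G w).IsIrreducible := by
  refine ⟨Pmh_nonneg hw, ?_⟩
  let _ : Quiver V := (Pmh G w).toQuiver
  have hsc : Quiver.IsStronglyConnected V := fun i j => by
    induction hconn i j with
    | refl => exact ⟨Quiver.Path.nil⟩
    | @tail b c _ h ih =>
      -- Loops are skipped, since the diagonal entry of `Pmh` may vanish.
      by_cases hbc : b = c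
      · exact hbc ▸ ih
      · obtain ⟨q⟩ := ih
        refine ⟨q.cons ⟨?_⟩⟩
        rw [Pmh, if_neg hbc]
        exact mhOffDiag_pos hw hsymm hbc h
  obtain ⟨i⟩ := ‹Nonempty V›
  -- Irreducibility asks for paths of positive length; one arrow suffices for this, and a row of sum
  -- `1` has a positive entry.
  obtain ⟨j, -, hj⟩ := Finset.exists_lt_of_sum_lt (s := Finset.univ) (f := fun _ => (0 : ℝ))
    (g := Pmh G w i) (by rw [sum_Pmh]; simp)
  exact hsc.isSStronglyConnected_of_hom (i₀ := i) (j₀ := j) ⟨hj⟩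

lemma isRandomizedTrajectory_Pmh [Nonempty V] (hw : ∀ i, 0 < w i) (hloop : ∀ i, G.Adj i i)
    (hsymm : ∀ i j, G.Adj i j → G.Adj j i) (hconn : ∀ i j, Relation.ReflTransGen G.Adj i j) :
    IsRandomizedTrajectory G (Pmh G w) where
  stochastic := Pmh_mem_rowStochastic hw
  supported i j h := by
    have hij : i ≠ j := fun hij => h (hij ▸ hloop i)
    rw [Pmh, if_neg hij, mhOffDiag, if_neg fun h' => h h'.2]
  irreducible := Pmh_isIrreducible hw hsymm hconn

end MetropolisHastings

/-! ### Peak age as the reciprocal of the visit frequency -/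

section Trajectory

variable {V : Type u} [DecidableEq V]

/-- The ages at the visits telescope. -/
lemma sum_age_add_age (a : V → ℕ) (m : ℕ → V) (i : V) (T : ℕ) :
    ∑ t ∈ Finset.Icc 1 T, (age a m i t : ℝ) * (if m t = i then 1 else 0) + age a m i (T + 1) =
      T + age a m i 1 := by
  induction T with
  | zero => simp
  | succ T ih =>
    rw [Finset.sum_Icc_succ_top (by omega), age.eq_2 a m i (T + 1)]
    split_ifs <;> push_cast <;> linarith

lemma frequently_visit {m : ℕ → V} {i : V} {p : ℝ} (hp : 0 < p)
    (h : Tendsto (fun T : ℕ => (∑ t ∈ Finset.Icc 1 T, if m t = i then (1 : ℝ) else 0) / T)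
      atTop (nhds p)) : ∃ᶠ T in atTop, m T = i := by
  intro hne
  obtain ⟨n, hn⟩ := eventually_atTop.1 hne
  have hconst : ∀ T ≥ n, (∑ t ∈ Finset.Icc 1 T, if m t = i then (1 : ℝ) else 0) =
      ∑ t ∈ Finset.Icc 1 n, if m t = i then (1 : ℝ) else 0 := by
    intro T hT
    induction T, hT using Nat.le_induction with
    | base => rfl
    | succ T hT ih =>
      rw [Finset.sum_Icc_succ_top (by omega), ih, if_neg (hn _ (by omega)), add_zero]
  have h0 := tendsto_const_div_atTop_nhds_zero_nat
    (∑ t ∈ Finset.Icc 1 n, if m t = i then (1 : ℝ) else 0)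
  have := tendsto_nhds_unique h (h0.congr' (by
    filter_upwards [eventually_ge_atTop n] with T hT
    rw [hconst T hT]))
  exact hp.ne' this

/-- If the visits to `i` have the asymptotic frequency `p > 0`, the peak age of `i` is `1 / p`. -/
lemma peakAge_eq_of_tendsto (a : V → ℕ) {m : ℕ → V} {i : V} {p : ℝ} (hp : 0 < p)
    (h : Tendsto (fun T : ℕ => (∑ t ∈ Finset.Icc 1 T, if m t = i then (1 : ℝ) else 0) / T)
      atTop (nhds p)) : peakAge a m i = ENNReal.ofReal (1 / p) := by
  have hlim : ∀ c : ℝ, Tendsto (fun T : ℕ => ENNReal.ofReal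
      ((T + c) / ∑ t ∈ Finset.Icc 1 T, if m t = i then (1 : ℝ) else 0)) atTop
      (nhds (ENNReal.ofReal (1 / p))) := by
    intro c
    refine (ENNReal.continuous_ofReal.tendsto _).comp ?_
    have h1 : Tendsto (fun T : ℕ => 1 + c / (T : ℝ)) atTop (nhds 1) := by
      simpa using (tendsto_const_div_atTop_nhds_zero_nat c).const_add 1
    refine (h1.div h hp.ne').congr' ?_
    filter_upwards [eventually_gt_atTop 0] with T hT
    have hT' : (T : ℝ) ≠ 0 := by positivity
    rw [Pi.div_apply, one_add_div hT', div_div_div_cancel_right₀ hT']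
  have hN : ∀ T : ℕ, 0 ≤ ∑ t ∈ Finset.Icc 1 T, if m t = i then (1 : ℝ) else 0 := fun T =>
    Finset.sum_nonneg fun t _ => by split_ifs <;> norm_num
  apply le_antisymm
  -- Upper bound: drop the nonnegative current age from the telescoped identity.
  · rw [← (hlim (age a m i 1)).limsup_eq]
    refine limsup_le_limsup (Eventually.of_forall fun T => ENNReal.ofReal_le_ofReal ?_)
    refine div_le_div_of_nonneg_right ?_ (hN T)
    have := sum_age_add_age a m i T
    have h0 : (0 : ℝ) ≤ age a m i (T + 1) := Nat.cast_nonneg _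
    linarith
  -- Lower bound: right after a visit at `T` the age is `1`, so the sum is at least `T - 1`. Such
  -- `T` occur infinitely often, which is enough for a limsup.
  · refine le_of_forall_lt fun b hb => ?_
    obtain ⟨b', hb', hb''⟩ := exists_between hb
    refine hb'.trans_le (le_limsup_of_frequently_le ?_)
    refine ((frequently_visit hp h).and_eventually ((hlim (-1)).eventually_const_lt hb'')).mono ?_
    rintro T ⟨hT, hlt⟩
    refine hlt.le.trans (ENNReal.ofReal_le_ofReal (div_le_div_of_nonneg_right ?_ (hN T)))
    have := sum_age_add_age a m i T
    rw [age.eq_2 a m i T, if_pos hT] at this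
    have h0 : (0 : ℝ) ≤ age a m i 1 := Nat.cast_nonneg _
    push_cast at this
    linarith

end Trajectory

/-! ### From convergence along squares to convergence -/

section LargeNumbers

/-- A real sequence with bounded increments that is sublinear along the squares is sublinear. -/
lemma tendsto_div_of_tendsto_div_sq {z : ℕ → ℝ} {K : ℝ} (hK : ∀ n, |z (n + 1) - z n| ≤ K)
    (h : Tendsto (fun n : ℕ => z (n ^ 2) / (n : ℝ) ^ 2) atTop (nhds 0)) :
    Tendsto (fun n : ℕ => z n / n) atTop (nhds 0) := by
  have hsqrt : Tendsto Nat.sqrt atTop atTop := by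
    refine tendsto_atTop.2 fun b => ?_
    filter_upwards [eventually_ge_atTop (b ^ 2)] with n hn
    exact Nat.le_sqrt'.2 hn
  have hinc : ∀ n k, |z (n + k) - z n| ≤ K * k := by
    intro n k
    induction k with
    | zero => simp
    | succ k ih =>
      have := abs_sub_le (z (n + (k + 1))) (z (n + k)) (z n)
      have := hK (n + k)
      rw [← add_assoc] at *
      push_cast
      linarith
  -- The nearest square below `n` is within `2 * n.sqrt`, so moving to it costs at most `2 * K *
  -- n.sqrt`.
  have hbound : Tendsto (fun n : ℕ => |z (n ^ 2) / (n : ℝ) ^ 2| + 2 * K / (n : ℝ)) atTop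
      (nhds 0) := by
    simpa using h.abs.add (tendsto_const_div_atTop_nhds_zero_nat (2 * K))
  have hK0 : 0 ≤ K := (abs_nonneg _).trans (hK 0)
  refine squeeze_zero_norm' ?_ (hbound.comp hsqrt)
  filter_upwards [eventually_ge_atTop 1] with n hn
  have hs1 : 1 ≤ n.sqrt := Nat.le_sqrt'.2 (by simpa using hn)
  have hs2 : n.sqrt ^ 2 ≤ n := Nat.sqrt_le' n
  have hs3 : n ≤ n.sqrt ^ 2 + 2 * n.sqrt := by
    have := Nat.sqrt_le_add n
    rw [sq]; omega
  obtain ⟨k, hk⟩ := Nat.exists_eq_add_of_le hs2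
  have hk2 : k ≤ 2 * n.sqrt := by omega
  have hz : |z n| ≤ |z (n.sqrt ^ 2)| + 2 * K * n.sqrt := by
    have h1 := hinc (n.sqrt ^ 2) k
    rw [← hk] at h1
    have h2 := abs_sub_abs_le_abs_sub (z n) (z (n.sqrt ^ 2))
    have h3 : K * k ≤ K * (2 * n.sqrt) := by gcongr; exact_mod_cast hk2
    linarith
  have hs0 : (0 : ℝ) < n.sqrt := by exact_mod_cast hs1
  have hs2' : ((n.sqrt : ℝ)) ^ 2 ≤ n := by exact_mod_cast hs2
  simp only [Function.comp, Real.norm_eq_abs, abs_div, Nat.abs_cast]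
  calc |z n| / n ≤ |z n| / (n.sqrt : ℝ) ^ 2 := by gcongr
    _ ≤ (|z (n.sqrt ^ 2)| + 2 * K * n.sqrt) / (n.sqrt : ℝ) ^ 2 := by gcongr
    _ = _ := by
      rw [abs_of_pos (pow_pos hs0 2)]
      field_simp

/-- Summable second moments force almost sure convergence to zero. -/
lemma ae_tendsto_zero_of_integral_sq_le {Ω : Type v} [MeasurableSpace Ω] {μ : Measure Ω}
    {Y : ℕ → Ω → ℝ} {b : ℕ → ℝ} (hY : ∀ n, Measurable (Y n))
    (hint : ∀ n, Integrable (fun ω => Y n ω ^ 2) μ) (hle : ∀ n, ∫ ω, Y n ω ^ 2 ∂μ ≤ b n)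
    (hb : Summable b) : ∀ᵐ ω ∂μ, Tendsto (fun n => Y n ω) atTop (nhds 0) := by
  have hmeas : ∀ n, Measurable fun ω => ENNReal.ofReal (Y n ω ^ 2) := fun n =>
    ((hY n).pow_const 2).ennreal_ofReal
  have hfin : ∫⁻ ω, ∑' n, ENNReal.ofReal (Y n ω ^ 2) ∂μ ≠ ∞ := by
    rw [lintegral_tsum fun n => (hmeas n).aemeasurable]
    refine ne_top_of_le_ne_top hb.tsum_ofReal_ne_top (ENNReal.tsum_le_tsum fun n => ?_)
    rw [← ofReal_integral_eq_lintegral_ofReal (hint n) (Eventually.of_forall fun ω => sq_nonneg _)]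
    exact ENNReal.ofReal_le_ofReal (hle n)
  filter_upwards [ae_lt_top (Measurable.tsum hmeas) hfin] with ω hω
  have h1 := ENNReal.tendsto_atTop_zero_of_tsum_ne_top hω.ne
  have h2 := (ENNReal.tendsto_toReal ENNReal.zero_ne_top).comp h1
  simp only [Function.comp_def, ENNReal.toReal_ofReal (sq_nonneg _), ENNReal.toReal_zero] at h2
  have h3 := h2.sqrt
  simp only [Real.sqrt_sq_eq_abs, Real.sqrt_zero] at h3
  exact (tendsto_zero_iff_abs_tendsto_zero _).2 h3

end LargeNumbers

/-! ### Finite paths and the Markov property -/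

section Paths

variable {V : Type u}

/-- The path that follows `x` and stays at its last state. -/
def extendPath {n : ℕ} (x : Fin (n + 1) → V) (k : ℕ) : V := x (Fin.ofNat (n + 1) (min k n))

lemma extendPath_apply (n : ℕ) (x : ℕ → V) {k : ℕ} (hk : k ≤ n) :
    extendPath (fun l : Fin (n + 1) => x l) k = x k := by
  simp [extendPath, Nat.mod_eq_of_lt (Nat.lt_succ_of_le hk), min_eq_left hk]

/-- Factors a functional of the past through `Fin (n + 1) → V`; for finite `V` measurability and
integrability are then automatic, and integrals are finite sums. -/
lemma apply_extendPath {n : ℕ} {F : (ℕ → V) → ℝ} (hF : DependsOn F (Set.Iic n)) (x : ℕ → V) :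
    F (extendPath fun l : Fin (n + 1) => x l) = F x :=
  hF fun _ hk => extendPath_apply n x hk

lemma IsMarkovChain.measureReal_path_succ {P : Matrix V V ℝ} {Ω : Type v} [MeasurableSpace Ω]
    {μ : Measure Ω} {m : ℕ → Ω → V} (hP : ∀ i j, 0 ≤ P i j) (h : IsMarkovChain P μ m) {n : ℕ}
    (x : Fin (n + 1) → V) (j : V) :
    μ.real {ω | (fun l : Fin (n + 1) => m l ω) = x ∧ m (n + 1) ω = j} =
      μ.real {ω | (fun l : Fin (n + 1) => m l ω) = x} * P (x (Fin.last n)) j := by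
  let y : ℕ → V := fun k => if hk : k < n + 1 then x ⟨k, hk⟩ else j
  have hpath : ∀ ω, (∀ k ≤ n, m k ω = y k) ↔ (fun l : Fin (n + 1) => m l ω) = x := by
    intro ω
    constructor
    · intro hk
      ext l
      have := hk l (Nat.lt_succ_iff.1 l.2)
      rwa [show y l = x l from dif_pos l.2] at this
    · intro hx k hk
      rw [show y k = x ⟨k, Nat.lt_succ_of_le hk⟩ from dif_pos (Nat.lt_succ_of_le hk), ← hx]
  have hsucc : ∀ ω, (∀ k ≤ n + 1, m k ω = y k) ↔
      ((fun l : Fin (n + 1) => m l ω) = x ∧ m (n + 1) ω = j) := by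
    intro ω
    rw [← hpath]
    have hy : y (n + 1) = j := by simp [y]
    constructor
    · exact fun hk => ⟨fun k hkn => hk k (by omega), hy ▸ hk (n + 1) le_rfl⟩
    · rintro ⟨h1, h2⟩ k hk
      rcases Nat.le_succ_iff.1 hk with hk | rfl
      · exact h1 k hk
      · rw [h2, hy]
  have ht := h.transition n y
  have hyn : y n = x (Fin.last n) := by simp [y]; rfl
  have hyn' : y (n + 1) = j := by simp [y]
  simp only [hpath, hsucc, hyn, hyn'] at ht
  rw [Measure.real, ht, ENNReal.toReal_mul, ENNReal.toReal_ofReal (hP _ _), Measure.real]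

end Paths

/-! ### Law of large numbers and optimality -/

section MarkovChain

variable {V : Type u} [Fintype V] {P : Matrix V V ℝ} {Ω : Type v}
  [MeasurableSpace Ω] {μ : Measure Ω} {m : ℕ → Ω → V}

lemma IsMarkovChain.measurable (h : IsMarkovChain P μ m) (t : ℕ) : Measurable[_, ⊤] (m t) := by
  let _ : MeasurableSpace V := ⊤
  exact measurable_to_countable' fun i => h.measurableSet_eq t i

lemma IsMarkovChain.measurable_of_dependsOn (h : IsMarkovChain P μ m) {n : ℕ} {F : (ℕ → V) → ℝ}
    (hF : DependsOn F (Set.Iic n)) : Measurable fun ω => F fun k => m k ω := by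
  let _ : MeasurableSpace V := ⊤
  have hX : Measurable fun ω => fun l : Fin (n + 1) => m l ω :=
    measurable_pi_lambda _ fun l => h.measurable l
  rw [show (fun ω => F fun k => m k ω) =
    (fun x : Fin (n + 1) → V => F (extendPath x)) ∘ fun ω => fun l : Fin (n + 1) => m l ω from
      funext fun ω => (apply_extendPath hF fun k => m k ω).symm]
  exact (measurable_of_countable _).comp hX

lemma IsMarkovChain.integrable_of_dependsOn (h : IsMarkovChain P μ m) {n : ℕ} {F : (ℕ → V) → ℝ}
    (hF : DependsOn F (Set.Iic n)) : Integrable (fun ω => F fun k => m k ω) μ := by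
  have := h.isProbabilityMeasure
  let _ : MeasurableSpace V := ⊤
  have hX : Measurable fun ω => fun l : Fin (n + 1) => m l ω :=
    measurable_pi_lambda _ fun l => h.measurable l
  have hi : Integrable (fun x : Fin (n + 1) → V => F (extendPath x))
    (μ.map fun ω => fun l : Fin (n + 1) => m l ω) := Integrable.of_finite
  exact (hi.comp_measurable hX).congr
    (Eventually.of_forall fun ω => apply_extendPath hF fun k => m k ω)

/-- The increments `g (m (n+1)) - P g (m n)` are orthogonal to the past. -/
lemma IsMarkovChain.integral_mul_increment [DecidableEq V] (hP : P ∈ Matrix.rowStochastic ℝ V)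
    (h : IsMarkovChain P μ m) {n : ℕ} {F : (ℕ → V) → ℝ} (hF : DependsOn F (Set.Iic n))
    (g : V → ℝ) :
    ∫ ω, F (fun k => m k ω) * (g (m (n + 1) ω) - (P *ᵥ g) (m n ω)) ∂μ = 0 := by
  have := h.isProbabilityMeasure
  let _ : MeasurableSpace V := ⊤
  have hX : Measurable fun ω => fun l : Fin (n + 1) => m l ω :=
    measurable_pi_lambda _ fun l => h.measurable l
  have hXY : Measurable fun ω => ((fun l : Fin (n + 1) => m l ω), m (n + 1) ω) :=
    hX.prodMk (h.measurable (n + 1))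
  let H : (Fin (n + 1) → V) × V → ℝ := fun z =>
    F (extendPath z.1) * (g z.2 - (P *ᵥ g) (z.1 (Fin.last n)))
  have hH : ∀ ω, F (fun k => m k ω) * (g (m (n + 1) ω) - (P *ᵥ g) (m n ω)) =
      H ((fun l : Fin (n + 1) => m l ω), m (n + 1) ω) := fun ω => by
    simp only [H, apply_extendPath hF (fun k => m k ω), Fin.val_last]
  simp only [hH]
  rw [← integral_map hXY.aemeasurable Integrable.of_finite.aestronglyMeasurable,
    integral_fintype Integrable.of_finite, Fintype.sum_prod_type]
  refine Finset.sum_eq_zero fun x _ => ?_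
  have hmass : ∀ j, (μ.map fun ω => ((fun l : Fin (n + 1) => m l ω), m (n + 1) ω)).real {(x, j)} =
      μ.real {ω | (fun l : Fin (n + 1) => m l ω) = x} * P (x (Fin.last n)) j := fun j => by
    rw [← h.measureReal_path_succ (fun _ _ => Matrix.nonneg_of_mem_rowStochastic hP),
      map_measureReal_apply hXY (measurableSet_singleton _)]
    congr 1
    ext ω
    simp
  -- Given the path `x`, the increment has conditional mean zero.
  have hsum : ∑ j, P (x (Fin.last n)) j * (g j - (P *ᵥ g) (x (Fin.last n))) = 0 := by
    simp only [mul_sub, Finset.sum_sub_distrib]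
    rw [← Finset.sum_mul, Matrix.sum_row_of_mem_rowStochastic hP, one_mul]
    exact sub_self _
  calc _ = ∑ j, μ.real {ω | (fun l : Fin (n + 1) => m l ω) = x} * F (extendPath x) *
        (P (x (Fin.last n)) j * (g j - (P *ᵥ g) (x (Fin.last n)))) :=
        Finset.sum_congr rfl fun j _ => by rw [hmass, smul_eq_mul]; ring
    _ = 0 := by rw [← Finset.mul_sum, hsum, mul_zero]

/-- Strong law of large numbers for functionals `f = g - P g` of a Markov chain. -/
lemma IsMarkovChain.ae_tendsto_sum_div [DecidableEq V] (hP : P ∈ Matrix.rowStochastic ℝ V)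
    (h : IsMarkovChain P μ m) {f g : V → ℝ} (hg : ∀ i, g i = f i + (P *ᵥ g) i) :
    ∀ᵐ ω ∂μ, Tendsto (fun T : ℕ => (∑ t ∈ Finset.Icc 1 T, f (m t ω)) / T) atTop (nhds 0) := by
  have hprob := h.isProbabilityMeasure
  -- The martingale: by the Poisson equation its increments are `g (x (T + 1)) - (P *ᵥ g) (x T)`.
  let Z : ℕ → (ℕ → V) → ℝ := fun T x => ∑ t ∈ Finset.Icc 1 T, f (x t) + (P *ᵥ g) (x T)
  have hZ : ∀ T, DependsOn (Z T) (Set.Iic T) := fun T x y hxy => by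
    simp only [Z]
    rw [hxy T (Set.mem_Iic.2 le_rfl), Finset.sum_congr rfl fun t ht => by
      rw [hxy t (Finset.mem_Icc.1 ht).2]]
  have hstep : ∀ T x, Z (T + 1) x - Z T x = g (x (T + 1)) - (P *ᵥ g) (x T) := fun T x => by
    simp only [Z]
    rw [Finset.sum_Icc_succ_top (by omega), hg]
    ring
  obtain ⟨K, hK⟩ : ∃ K, ∀ i j, |g i - (P *ᵥ g) j| ≤ K := by
    obtain ⟨K, hK⟩ := (Set.finite_range fun z : V × V => |g z.1 - (P *ᵥ g) z.2|).bddAbove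
    exact ⟨K, fun i j => hK ⟨(i, j), rfl⟩⟩
  have hdep : ∀ T, DependsOn (fun x : ℕ → V => g (x (T + 1)) - (P *ᵥ g) (x T)) (Set.Iic (T + 1)) :=
    fun T x y hxy => by
      simp only [hxy (T + 1) (Set.mem_Iic.2 le_rfl), hxy T (Set.mem_Iic.2 (Nat.le_succ T))]
  have hZsucc : ∀ T, DependsOn (Z T) (Set.Iic (T + 1)) := fun T x y hxy =>
    hZ T fun k hk => hxy k (Set.mem_Iic.2 ((Set.mem_Iic.1 hk).trans (Nat.le_succ T)))
  -- The cross term vanishes by orthogonality, so each step adds at most `K ^ 2`.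
  have hmoment : ∀ T : ℕ, ∫ ω, Z T (fun k => m k ω) ^ 2 ∂μ ≤
      ∫ ω, Z 0 (fun k => m k ω) ^ 2 ∂μ + K ^ 2 * T := by
    intro T
    induction T with
    | zero => simp
    | succ T ih =>
      have hi1 : Integrable (fun ω => Z T (fun k => m k ω) ^ 2) μ :=
        h.integrable_of_dependsOn (n := T) (F := fun x => Z T x ^ 2) fun x y hxy => by
          simp only [hZ T hxy]
      have hi2 : Integrable (fun ω => 2 * (Z T (fun k => m k ω) *
          (g (m (T + 1) ω) - (P *ᵥ g) (m T ω)))) μ :=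
        (h.integrable_of_dependsOn (n := T + 1)
          (F := fun x => Z T x * (g (x (T + 1)) - (P *ᵥ g) (x T))) fun x y hxy => by
            have := hdep T hxy
            simp only at this
            simp only [hZsucc T hxy, this]).const_mul 2
      have hi3 : Integrable (fun ω => (g (m (T + 1) ω) - (P *ᵥ g) (m T ω)) ^ 2) μ :=
        h.integrable_of_dependsOn (n := T + 1)
          (F := fun x => (g (x (T + 1)) - (P *ᵥ g) (x T)) ^ 2) fun x y hxy => by
            have := hdep T hxy
            simp only at this
            simp only [this]
      have hexp : ∀ ω, Z (T + 1) (fun k => m k ω) ^ 2 = Z T (fun k => m k ω) ^ 2 +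
          2 * (Z T (fun k => m k ω) * (g (m (T + 1) ω) - (P *ᵥ g) (m T ω))) +
          (g (m (T + 1) ω) - (P *ᵥ g) (m T ω)) ^ 2 := fun ω => by
        have := hstep T fun k => m k ω
        rw [eq_add_of_sub_eq this]
        ring
      have hle : ∫ ω, (g (m (T + 1) ω) - (P *ᵥ g) (m T ω)) ^ 2 ∂μ ≤ K ^ 2 := by
        refine (integral_mono hi3 (integrable_const (K ^ 2)) fun ω => ?_).trans_eq (by simp)
        exact sq_le_sq' (abs_le.1 (hK _ _)).1 (abs_le.1 (hK _ _)).2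
      simp only [hexp]
      rw [integral_add ?_ hi3, integral_add hi1 hi2, integral_const_mul,
        h.integral_mul_increment hP (hZ T)]
      · push_cast
        linarith
      · exact hi1.add hi2
  set C := ∫ ω, Z 0 (fun k => m k ω) ^ 2 ∂μ
  have hC0 : 0 ≤ C := integral_nonneg fun ω => sq_nonneg _
  have hsq : ∀ᵐ ω ∂μ, Tendsto (fun n : ℕ => Z (n ^ 2) (fun k => m k ω) / (n : ℝ) ^ 2) atTop
      (nhds 0) := by
    -- The second moment of `Z (n ^ 2) / n ^ 2` is at most `(C + K ^ 2 * n ^ 2) / n ^ 4`; for `n =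
    -- 0` both sides are `0` by the convention on division.
    have hsumm : Summable fun n : ℕ => (C + K ^ 2) * (1 / (n : ℝ) ^ 2) :=
      (Real.summable_one_div_nat_pow.2 one_lt_two).mul_left _
    refine ae_tendsto_zero_of_integral_sq_le
      (fun n => (h.measurable_of_dependsOn (hZ (n ^ 2))).div_const _) (fun n => ?_) (fun n => ?_)
      hsumm
    · exact h.integrable_of_dependsOn (n := n ^ 2) (F := fun x => (Z (n ^ 2) x / (n : ℝ) ^ 2) ^ 2)
        fun x y hxy => by simp only [hZ (n ^ 2) hxy]
    · simp only [div_pow, integral_div]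
      rcases Nat.eq_zero_or_pos n with rfl | hn
      · simp
      · have hn1 : (1 : ℝ) ≤ (n : ℝ) ^ 2 := one_le_pow₀ (by exact_mod_cast hn)
        have hm := hmoment (n ^ 2)
        push_cast at hm
        rw [mul_one_div, div_le_div_iff₀ (by positivity) (by positivity)]
        have : ∫ ω, Z (n ^ 2) (fun k => m k ω) ^ 2 ∂μ ≤ (C + K ^ 2) * (n : ℝ) ^ 2 := by
          nlinarith
        calc _ ≤ (C + K ^ 2) * (n : ℝ) ^ 2 * (n : ℝ) ^ 2 := by gcongr
          _ = _ := by ring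
  obtain ⟨B, hB⟩ := (Set.finite_range fun i => |(P *ᵥ g) i|).bddAbove
  filter_upwards [hsq] with ω hω
  have hlin := tendsto_div_of_tendsto_div_sq (z := fun n => Z n fun k => m k ω) (K := K)
    (fun n => by rw [hstep]; exact hK _ _) hω
  have hrem : Tendsto (fun T : ℕ => (P *ᵥ g) (m T ω) / (T : ℝ)) atTop (nhds 0) := by
    refine squeeze_zero_norm (fun T => ?_) (tendsto_const_div_atTop_nhds_zero_nat B)
    rw [norm_div, Real.norm_eq_abs, Real.norm_natCast]
    exact div_le_div_of_nonneg_right (hB ⟨_, rfl⟩) (Nat.cast_nonneg _)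
  have := hlin.sub hrem
  rw [sub_zero] at this
  refine this.congr fun T => ?_
  simp only [Z]
  ring

/-- The visits of an irreducible chain to `i` have the stationary probability of `i` as their
asymptotic frequency. -/
lemma IsMarkovChain.ae_tendsto_visits [DecidableEq V] [Nonempty V]
    (hP : P ∈ Matrix.rowStochastic ℝ V) (hirr : P.IsIrreducible) {p : V → ℝ}
    (hp : p ∈ stdSimplex ℝ V) (hst : p ᵥ* P = p) (h : IsMarkovChain P μ m) (i : V) :
    ∀ᵐ ω ∂μ, Tendsto (fun T : ℕ => (∑ t ∈ Finset.Icc 1 T, if m t ω = i then (1 : ℝ) else 0) / T)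
      atTop (nhds (p i)) := by
  let f : V → ℝ := fun j => (if j = i then 1 else 0) - p i
  have hf : p ⬝ᵥ f = 0 := by
    simp only [dotProduct, f, mul_sub, Finset.sum_sub_distrib, ← Finset.sum_mul, hp.2]
    simp
  obtain ⟨g, hg⟩ := exists_poisson_solution hP hirr hp hst hf
  filter_upwards [h.ae_tendsto_sum_div hP hg] with ω hω
  have := hω.add_const (p i)
  rw [zero_add] at this
  refine this.congr' ?_
  filter_upwards [eventually_gt_atTop 0] with T hT
  have hT' : (T : ℝ) ≠ 0 := by positivity
  simp only [f, Finset.sum_sub_distrib, Finset.sum_const, Nat.card_Icc, Nat.add_sub_cancel,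
    nsmul_eq_mul]
  field_simp
  ring

/-- The network peak age of an irreducible chain is `∑ i, w i / p i`, where `p` is its stationary
distribution. -/
lemma hasPeakAge_of_stationary [DecidableEq V] [Nonempty V] {w : V → ℝ} (hw : ∀ i, 0 < w i)
    (hP : P ∈ Matrix.rowStochastic ℝ V) (hirr : P.IsIrreducible) {p : V → ℝ}
    (hp : p ∈ stdSimplex ℝ V) (hst : p ᵥ* P = p) :
    HasPeakAge.{u, v} w P (∑ i, w i / p i).toNNReal := by
  intro Ω _ μ m h a
  have hpos := pos_of_vecMul_eq_self hirr hp hst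
  filter_upwards [ae_all_iff.2 (h.ae_tendsto_visits hP hirr hp hst)] with ω hω
  have hterm : ∀ i, ENNReal.ofReal (w i) * peakAge a (fun t => m t ω) i =
      ENNReal.ofReal (w i / p i) := fun i => by
    rw [peakAge_eq_of_tendsto a (hpos i) (hω i), ← ENNReal.ofReal_mul (hw i).le, mul_one_div]
  rw [networkPeakAge, Finset.sum_congr rfl fun i _ => hterm i,
    ← ENNReal.ofReal_sum_of_nonneg fun i _ => (div_pos (hw i) (hpos i)).le]
  rfl

lemma isPeakAgeOptimal_of_piStar_stationary [DecidableEq V] [Nonempty V] {G : Digraph V}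
    {w : V → ℝ} (hw : ∀ i, 0 < w i) (hP : IsRandomizedTrajectory G P)
    (hst : piStar w ᵥ* P = piStar w) : IsPeakAgeOptimal.{u, v} G w P := by
  refine ⟨hP, _, hasPeakAge_of_stationary hw hP.stochastic hP.irreducible
    (piStar_mem_stdSimplex hw) hst, fun Q hQ => ?_⟩
  obtain ⟨p, hp, hpQ⟩ := exists_stationary hQ.stochastic
  exact ⟨_, hasPeakAge_of_stationary hw hQ.stochastic hQ.irreducible hp hpQ,
    Real.toNNReal_le_toNNReal
      (sum_div_piStar_le hw (pos_of_vecMul_eq_self hQ.irreducible hp hpQ) hp.2)⟩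

end MarkovChain

end PeakAge

theorem theorem2 {V : Type u} [Fintype V] [DecidableEq V] [Nonempty V]
    (G : Digraph V) [DecidableRel G.Adj] (w : V → ℝ) (hw : ∀ i, 0 < w i) :
    (∀ P : Matrix V V ℝ, PeakAge.IsRandomizedTrajectory G P →
      PeakAge.piStar w ᵥ* P = PeakAge.piStar w →
        PeakAge.SolvesPeakAgeProblem G w P (PeakAge.piStar w) ∧
        PeakAge.IsPeakAgeOptimal.{u, v} G w P) ∧
    ((∀ i, G.Adj i i) → (∀ i j, G.Adj i j → G.Adj j i) →
      (∀ i j, Relation.ReflTransGen G.Adj i j) →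
        PeakAge.IsRandomizedTrajectory G (PeakAge.Pmh G w) ∧
        PeakAge.piStar w ᵥ* PeakAge.Pmh G w = PeakAge.piStar w ∧
        PeakAge.SolvesPeakAgeProblem G w (PeakAge.Pmh G w) (PeakAge.piStar w) ∧
        PeakAge.IsPeakAgeOptimal.{u, v} G w (PeakAge.Pmh G w)) := by
  refine ⟨fun P hP hst => ⟨PeakAge.solvesPeakAgeProblem_piStar hw hP hst,
    PeakAge.isPeakAgeOptimal_of_piStar_stationary hw hP hst⟩, fun hloop hsymm hconn => ?_⟩
  have hP := PeakAge.isRandomizedTrajectory_Pmh hw hloop hsymm hconn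
  have hst := PeakAge.piStar_vecMul_Pmh hw hsymm
  exact ⟨hP, hst, PeakAge.solvesPeakAgeProblem_piStar hw hP hst,
    PeakAge.isPeakAgeOptimal_of_piStar_stationary hw hP hst⟩
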